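/- Let $0<a<1$, $a\neq 1/2$, and let $\omega_1,\omega_2,\dots$ be independent random digits with $P(\omega_n=0)=a$ and $P(\omega_n=1)=1-a$. Let $L_a(x)=P\bigl(\sum_{n\ge1}\omega_n2^{-n}\le x\bigr)$, $0\le x\le1$, be Lebesgue's singular function; it is a strictly increasing continuous bijection of $[0,1]$ onto itself, with inverse $L_a^{-1}$. Let $T(x)=\sum_{k=0}^{\infty}2^{-k}\bigl|2^kx-\lfloor 2^kx+\tfrac12\rfloor\bigr|$ be Takagi's function. For $y\in[0,1]$ let $y=\sum_{k\ge1}\varepsilon_k2^{-k}$ be its binary expansion (the one that is eventually all zeros if there are two, except that $\varepsilon_k=1$ for all $k$ if $y=1$), let $D_1(y)=\lim_{n\to\infty}\frac1n\sum_{k=1}^n\varepsilon_k$ whenever this limit exists, and $D_0(y)=1-D_1(y)$. Let $x\in[0,1]$ and $y=L_a^{-1}(x)$. If $D_1(y)$ exists, $0<D_1(y)<1$ and $a^{D_0(y)}(1-a)^{D_1(y)}>\tfrac12$, then $T\circ L_a^{-1}$ is differentiable at $x$ and $$(T\circ L_a^{-1})'(x)=0 .$$ Moreover, for every such $a$, the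 set of points $x\in(0,1)$ at which $T\circ L_a^{-1}$ has derivative $0$ is uncountable. -/

import Mathlib

open Filter Topology MeasureTheory ProbabilityTheory

/-- The law of an infinite sequence of independent tosses of a coin with probability `a` of heads
(recorded as the digit `0`) and probability `1 - a` of tails (recorded as the digit `1`). -/
noncomputable def coinLaw (a : unitInterval) : Measure (ℕ → Fin 2) :=
  Measure.infinitePi fun _ => bernoulliMeasure 0 1 a

/-- Lebesgue's singular function `L_a(x) = prob {t ≤ x}`, where `t = ∑ ω_n / 2 ^ n` (`n ≥ 1`) has
the coin tosses as its binary digits; `Real.ofDigits ω = ∑' n, ω n / 2 ^ (n + 1)`. -/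
noncomputable def lebesgueSingular (a : unitInterval) (x : ℝ) : ℝ :=
  (coinLaw a).real {ω | Real.ofDigits ω ≤ x}

/-- The inverse of the bijection `L_a : [0, 1] → [0, 1]`. (Only its values on `[0, 1]` matter.) -/
noncomputable def lebesgueSingularInv (a : unitInterval) : ℝ → ℝ :=
  Function.invFunOn (lebesgueSingular a) (Set.Icc 0 1)

/-- The `k`-th binary digit (`k ≥ 1`) of `x ∈ [0, 1]`: dyadic `x < 1` get the expansion that is
eventually all zeros, and all digits of `x = 1` are `1`. -/
noncomputable def binDigit (x : ℝ) (k : ℕ) : ℕ :=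
  if x = 1 then 1 else ⌊2 ^ k * x⌋₊ % 2

/-- `I_n`, the number of ones among the first `n` binary digits of `x`. -/
noncomputable def onesCount (x : ℝ) (n : ℕ) : ℕ :=
  ∑ k ∈ Finset.Icc 1 n, binDigit x k

/-- The density `D_1(x) = lim I_n / n` exists and equals `d`. -/
def HasOnesDensity (x d : ℝ) : Prop :=
  Tendsto (fun n : ℕ => (onesCount x n : ℝ) / n) atTop (𝓝 d)

/-- Takagi's function. -/
noncomputable def takagi (x : ℝ) : ℝ :=
  ∑' k : ℕ, 1 / 2 ^ k * |2 ^ k * x - ⌊2 ^ k * x + 1 / 2⌋|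

/-- The digit sequence `c, ω 0, ω 1, …`. -/
def consDigit (c : Fin 2) (ω : ℕ → Fin 2) : ℕ → Fin 2
  | 0 => c
  | n + 1 => ω n

theorem measurable_consDigit (c : Fin 2) : Measurable (consDigit c) := by
  refine measurable_pi_iff.2 fun n => ?_
  cases n with
  | zero => exact measurable_const
  | succ n => exact measurable_pi_apply n

theorem ofDigits_consDigit (c : Fin 2) (ω : ℕ → Fin 2) :
    Real.ofDigits (consDigit c ω) = ((c : ℕ) + Real.ofDigits ω) / 2 := by
  rw [Real.ofDigits_eq_sum_add_ofDigits _ 1]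
  simp [Real.ofDigitsTerm, consDigit]
  ring

instance (a : unitInterval) : IsProbabilityMeasure (coinLaw a) := by
  unfold coinLaw; infer_instance

theorem preimage_consDigit_pi (c : Fin 2) (s : Finset ℕ) (t : ℕ → Set (Fin 2)) :
    consDigit c ⁻¹' (Set.pi s t) =
      {_ω | 0 ∈ s → c ∈ t 0} ∩
        Set.pi (s.preimage Nat.succ Nat.succ_injective.injOn) fun n => t (n + 1) := by
  ext ω
  simp only [Set.mem_preimage, Set.mem_pi, Set.mem_inter_iff, Set.mem_ofPred_eq,
    Finset.mem_coe, Finset.mem_preimage]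
  constructor
  · exact fun h => ⟨fun h0 => h 0 h0, fun n hn => h (n + 1) hn⟩
  · rintro ⟨h0, h⟩ (_ | n) hn
    · exact h0 hn
    · exact h n hn

theorem coinLaw_eq_add (a : unitInterval) :
    coinLaw a = unitInterval.toNNReal a • (coinLaw a).map (consDigit 0) +
      unitInterval.toNNReal (unitInterval.symm a) • (coinLaw a).map (consDigit 1) := by
  symm
  refine Measure.eq_infinitePi _ fun s t ht => ?_
  have hm : MeasurableSet (Set.pi (s : Set ℕ) t) :=
    MeasurableSet.pi s.countable_toSet fun i _ => ht i
  have hprod : ∏ i ∈ s, bernoulliMeasure (0 : Fin 2) 1 a (t i) =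
      (if 0 ∈ s then bernoulliMeasure (0 : Fin 2) 1 a (t 0) else 1) *
        ∏ n ∈ s.preimage Nat.succ Nat.succ_injective.injOn,
          bernoulliMeasure (0 : Fin 2) 1 a (t (n + 1)) := by
    classical
    have h1 := Finset.prod_preimage' Nat.succ s Nat.succ_injective.injOn
      (fun i => bernoulliMeasure (0 : Fin 2) 1 a (t i))
    have h2 : s.filter (· ∈ Set.range Nat.succ) = s.erase 0 := by
      ext n
      cases n <;> simp
    rw [h2] at h1
    simp only [Nat.succ_eq_add_one] at h1
    rw [h1]
    split_ifs with h
    · exact (Finset.mul_prod_erase s _ h).symm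
    · rw [Finset.erase_eq_of_notMem h, one_mul]
  have hcons (c : Fin 2) : (coinLaw a).map (consDigit c) (Set.pi s t) =
      Set.indicator {c | 0 ∈ s → c ∈ t 0} 1 c *
        ∏ n ∈ s.preimage Nat.succ Nat.succ_injective.injOn,
          bernoulliMeasure (0 : Fin 2) 1 a (t (n + 1)) := by
    rw [Measure.map_apply (measurable_consDigit c) hm, preimage_consDigit_pi]
    by_cases h : 0 ∈ s → c ∈ t 0
    · rw [Set.eq_univ_of_forall (s := {_ω | 0 ∈ s → c ∈ t 0}) fun _ => h, Set.univ_inter, coinLaw,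
        Measure.infinitePi_pi _ fun i _ => ht (i + 1)]
      rw [Set.indicator_of_mem (by exact h), Pi.one_apply, one_mul]
    · simp [h]
  rw [Measure.add_apply, Measure.smul_apply, Measure.smul_apply, hcons, hcons, hprod]
  classical
  by_cases h0 : 0 ∈ s
  · rw [if_pos h0, bernoulliMeasure_def, Measure.add_apply, Measure.smul_apply,
      Measure.smul_apply, Measure.dirac_apply' _ (ht 0), Measure.dirac_apply' _ (ht 0)]
    simp only [h0, forall_const, Set.ofPred_mem_eq, ENNReal.smul_def, smul_eq_mul, Set.indicator]
    ring
  · have : (bernoulliMeasure (0 : Fin 2) 1 a) Set.univ = 1 := measure_univ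
    rw [bernoulliMeasure_def, Measure.add_apply, Measure.smul_apply,
      Measure.smul_apply, measure_univ, measure_univ] at this
    simp only [h0, if_false, false_imp_iff, Set.ofPred_true, Set.indicator_univ, Pi.one_apply,
      ENNReal.smul_def, smul_eq_mul, mul_one, one_mul, ← add_mul] at this ⊢
    rw [this, one_mul]

theorem measurableSet_ofDigits_le (x : ℝ) :
    MeasurableSet {ω : ℕ → Fin 2 | Real.ofDigits ω ≤ x} :=
  Real.continuous_ofDigits.measurable measurableSet_Iic

/-- The functional equation of de Rham for the singular function of Lebesgue. -/
theorem lebesgueSingular_eq (a : unitInterval) (x : ℝ) :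
    lebesgueSingular a x =
      a * lebesgueSingular a (2 * x) + (1 - a) * lebesgueSingular a (2 * x - 1) := by
  have h0 : consDigit 0 ⁻¹' {ω | Real.ofDigits ω ≤ x} = {ω | Real.ofDigits ω ≤ 2 * x} := by
    ext ω
    simp only [Set.mem_preimage, Set.mem_ofPred_eq, ofDigits_consDigit]
    constructor <;> intro h <;> norm_num at h ⊢ <;> linarith
  have h1 : consDigit 1 ⁻¹' {ω | Real.ofDigits ω ≤ x} = {ω | Real.ofDigits ω ≤ 2 * x - 1} := by
    ext ω
    simp only [Set.mem_preimage, Set.mem_ofPred_eq, ofDigits_consDigit]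
    constructor <;> intro h <;> norm_num at h ⊢ <;> linarith
  have hm := measurableSet_ofDigits_le x
  conv_lhs => rw [lebesgueSingular, coinLaw_eq_add]
  rw [measureReal_add_apply, measureReal_nnreal_smul_apply, measureReal_nnreal_smul_apply,
    map_measureReal_apply (measurable_consDigit 0) hm,
    map_measureReal_apply (measurable_consDigit 1) hm, h0, h1]
  simp [lebesgueSingular]

theorem lebesgueSingular_mono (a : unitInterval) : Monotone (lebesgueSingular a) :=
  fun _ _ h => measureReal_mono fun _ hω => le_trans hω h

theorem lebesgueSingular_of_neg (a : unitInterval) {x : ℝ} (hx : x < 0) :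
    lebesgueSingular a x = 0 := by
  have : {ω : ℕ → Fin 2 | Real.ofDigits ω ≤ x} = ∅ := by
    ext ω
    simpa using hx.trans_le (Real.ofDigits_nonneg ω)
  simp [lebesgueSingular, this]

theorem lebesgueSingular_of_one_le (a : unitInterval) {x : ℝ} (hx : 1 ≤ x) :
    lebesgueSingular a x = 1 := by
  have : {ω : ℕ → Fin 2 | Real.ofDigits ω ≤ x} = Set.univ := by
    ext ω
    simpa using (Real.ofDigits_le_one ω).trans hx
  simp [lebesgueSingular, this]

theorem lebesgueSingular_zero {a : unitInterval} (ha : (a : ℝ) < 1) :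
    lebesgueSingular a 0 = 0 := by
  have h := lebesgueSingular_eq a 0
  rw [lebesgueSingular_of_neg a (x := 2 * 0 - 1) (by norm_num)] at h
  simp only [mul_zero, add_zero] at h
  have : (1 - (a : ℝ)) * lebesgueSingular a 0 = 0 := by linarith
  rcases mul_eq_zero.1 this with h | h
  · linarith
  · exact h

/-- The increment of `L_a` over the dyadic interval `[j / 2 ^ n, (j + 1) / 2 ^ n]`. -/
noncomputable def dyadicIncr (a : unitInterval) (n : ℕ) (j : ℤ) : ℝ :=
  lebesgueSingular a ((j + 1) / 2 ^ n) - lebesgueSingular a (j / 2 ^ n)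

theorem dyadicIncr_nonneg (a : unitInterval) (n : ℕ) (j : ℤ) : 0 ≤ dyadicIncr a n j :=
  sub_nonneg.2 <| lebesgueSingular_mono a <| by gcongr; linarith

theorem dyadicIncr_zero {a : unitInterval} (ha : (a : ℝ) < 1) (j : ℤ) :
    dyadicIncr a 0 j = if j = 0 then 1 else 0 := by
  unfold dyadicIncr
  simp only [pow_zero, div_one]
  rcases lt_trichotomy j 0 with hj | rfl | hj
  · have h1 : (j : ℝ) < 0 := by exact_mod_cast hj
    have h2 : (j : ℝ) + 1 ≤ 0 := by exact_mod_cast hj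
    have h3 : lebesgueSingular a (j + 1) = 0 :=
      le_antisymm ((lebesgueSingular_mono a h2).trans_eq (lebesgueSingular_zero ha))
        measureReal_nonneg
    rw [lebesgueSingular_of_neg a h1, h3, if_neg hj.ne, sub_zero]
  · simp [lebesgueSingular_of_one_le a le_rfl, lebesgueSingular_zero ha]
  · have h1 : (1 : ℝ) ≤ j := by exact_mod_cast hj
    rw [lebesgueSingular_of_one_le a h1, lebesgueSingular_of_one_le a (by linarith),
      if_neg hj.ne', sub_self]

theorem dyadicIncr_succ (a : unitInterval) (n : ℕ) (j : ℤ) :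
    dyadicIncr a (n + 1) j = a * dyadicIncr a n j + (1 - a) * dyadicIncr a n (j - 2 ^ n) := by
  unfold dyadicIncr
  have h (t : ℝ) : lebesgueSingular a (t / 2 ^ (n + 1)) =
      a * lebesgueSingular a (t / 2 ^ n) +
        (1 - a) * lebesgueSingular a ((t - 2 ^ n) / 2 ^ n) := by
    rw [lebesgueSingular_eq]
    congr 3 <;> field_simp <;> ring
  rw [h, h]
  push_cast
  rw [show (j : ℝ) - 2 ^ n + 1 = j + 1 - 2 ^ n by ring]
  ring

theorem dyadicIncr_succ_two_mul {a : unitInterval} (ha : (a : ℝ) < 1) (n : ℕ) (j : ℤ) :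
    dyadicIncr a (n + 1) (2 * j) = a * dyadicIncr a n j := by
  induction n generalizing j with
  | zero =>
    rw [dyadicIncr_succ, dyadicIncr_zero ha, dyadicIncr_zero ha, dyadicIncr_zero ha]
    have : 2 * j - 2 ^ 0 ≠ 0 := by omega
    rw [if_neg this]
    simp
  | succ n ih =>
    rw [dyadicIncr_succ, ih, show 2 * j - 2 ^ (n + 1) = 2 * (j - 2 ^ n) by ring, ih,
      dyadicIncr_succ a n]
    ring

theorem dyadicIncr_succ_two_mul_add_one {a : unitInterval} (ha : (a : ℝ) < 1) (n : ℕ) (j : ℤ) :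
    dyadicIncr a (n + 1) (2 * j + 1) = (1 - a) * dyadicIncr a n j := by
  induction n generalizing j with
  | zero =>
    rw [dyadicIncr_succ, dyadicIncr_zero ha, dyadicIncr_zero ha, dyadicIncr_zero ha]
    have : 2 * j + 1 ≠ 0 := by omega
    simp [this]
  | succ n ih =>
    rw [dyadicIncr_succ, ih, show 2 * j + 1 - 2 ^ (n + 1) = 2 * (j - 2 ^ n) + 1 by ring, ih,
      dyadicIncr_succ a n]
    ring

theorem dyadicIncr_succ_le_max_mul {a : unitInterval} (ha : (a : ℝ) < 1) (n : ℕ) (j : ℤ) :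
    dyadicIncr a (n + 1) j ≤ max (a : ℝ) (1 - a) * dyadicIncr a n (j / 2) := by
  have h0 := dyadicIncr_nonneg a n (j / 2)
  rcases Int.even_or_odd' j with ⟨k, rfl | rfl⟩
  · rw [dyadicIncr_succ_two_mul ha]
    rw [Int.mul_ediv_cancel_left _ two_ne_zero] at *
    gcongr
    exact le_max_left _ _
  · rw [dyadicIncr_succ_two_mul_add_one ha]
    rw [show (2 * k + 1) / 2 = k by omega] at *
    gcongr
    exact le_max_right _ _

theorem min_mul_le_dyadicIncr_succ {a : unitInterval} (ha : (a : ℝ) < 1) (n : ℕ) (j : ℤ) :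
    min (a : ℝ) (1 - a) * dyadicIncr a n (j / 2) ≤ dyadicIncr a (n + 1) j := by
  have h0 := dyadicIncr_nonneg a n (j / 2)
  rcases Int.even_or_odd' j with ⟨k, rfl | rfl⟩
  · rw [dyadicIncr_succ_two_mul ha]
    rw [Int.mul_ediv_cancel_left _ two_ne_zero] at *
    gcongr
    exact min_le_left _ _
  · rw [dyadicIncr_succ_two_mul_add_one ha]
    rw [show (2 * k + 1) / 2 = k by omega] at *
    gcongr
    exact min_le_right _ _

theorem min_pow_mul_le_dyadicIncr_add {a : unitInterval} (ha : (a : ℝ) < 1) (n m : ℕ) (j : ℤ) :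
    min (a : ℝ) (1 - a) ^ m * dyadicIncr a n (j / 2 ^ m) ≤ dyadicIncr a (n + m) j := by
  have hp : 0 ≤ min (a : ℝ) (1 - a) := le_min a.2.1 (by linarith)
  induction m generalizing j with
  | zero => simp
  | succ m ih =>
    refine le_trans ?_ (min_mul_le_dyadicIncr_succ ha (n + m) j)
    rw [pow_succ' _ m, pow_succ' _ m, ← Int.ediv_ediv_of_nonneg (by norm_num), mul_assoc]
    gcongr
    exact ih _

theorem dyadicIncr_le_max_pow {a : unitInterval} (ha : (a : ℝ) < 1) (n : ℕ) (j : ℤ) :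
    dyadicIncr a n j ≤ max (a : ℝ) (1 - a) ^ n := by
  have hp : 0 ≤ max (a : ℝ) (1 - a) := le_max_of_le_left a.2.1
  induction n generalizing j with
  | zero =>
    rw [dyadicIncr_zero ha]
    split_ifs <;> simp
  | succ n ih =>
    refine (dyadicIncr_succ_le_max_mul ha n j).trans ?_
    rw [pow_succ']
    gcongr
    exact ih _

theorem dyadicIncr_pos {a : unitInterval} (ha₀ : 0 < (a : ℝ)) (ha : (a : ℝ) < 1) (n : ℕ) {j : ℤ}
    (hj₀ : 0 ≤ j) (hj : j < 2 ^ n) : 0 < dyadicIncr a n j := by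
  have h := min_pow_mul_le_dyadicIncr_add ha 0 n j
  rw [Int.ediv_eq_zero_of_lt hj₀ hj, dyadicIncr_zero ha, if_pos rfl, zero_add, mul_one] at h
  exact (pow_pos (lt_min ha₀ (by linarith)) n).trans_le h

theorem lebesgueSingular_strictMonoOn {a : unitInterval} (ha₀ : 0 < (a : ℝ)) (ha : (a : ℝ) < 1) :
    StrictMonoOn (lebesgueSingular a) (Set.Icc 0 1) := by
  intro u hu v hv huv
  obtain ⟨n, hn⟩ := exists_pow_lt_of_lt_one (y := (1 / 2 : ℝ)) (half_pos (sub_pos.2 huv))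
    (by norm_num)
  have hpos : (0 : ℝ) < 2 ^ n := by positivity
  have hn' : 2 < 2 ^ n * (v - u) := by
    rw [one_div, inv_pow, inv_lt_iff_one_lt_mul₀ hpos] at hn
    linarith
  have h1 : u ≤ (⌈2 ^ n * u⌉ : ℝ) / 2 ^ n := by
    rw [le_div_iff₀ hpos, mul_comm]
    exact Int.le_ceil _
  have h3 := Int.ceil_lt_add_one (2 ^ n * u)
  have h2 : ((⌈2 ^ n * u⌉ : ℝ) + 1) / 2 ^ n ≤ v := by
    rw [div_le_iff₀ hpos]
    linarith
  have h4 : 0 < dyadicIncr a n ⌈2 ^ n * u⌉ := by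
    refine dyadicIncr_pos ha₀ ha n (Int.ceil_nonneg (mul_nonneg hpos.le hu.1)) ?_
    have : (⌈2 ^ n * u⌉ : ℝ) < 2 ^ n := by nlinarith [hv.2]
    exact_mod_cast this
  calc lebesgueSingular a u ≤ lebesgueSingular a ((⌈2 ^ n * u⌉ : ℝ) / 2 ^ n) :=
        lebesgueSingular_mono a h1
    _ < lebesgueSingular a (((⌈2 ^ n * u⌉ : ℝ) + 1) / 2 ^ n) := sub_pos.1 h4
    _ ≤ lebesgueSingular a v := lebesgueSingular_mono a h2

theorem lebesgueSingular_sub_le {a : unitInterval} (ha : (a : ℝ) < 1) (n : ℕ) {u v : ℝ}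
    (h : v ≤ u + 1 / 2 ^ n) :
    lebesgueSingular a v - lebesgueSingular a u ≤ 2 * max (a : ℝ) (1 - a) ^ n := by
  have hpos : (0 : ℝ) < 2 ^ n := by positivity
  have h1 : (⌊2 ^ n * u⌋ : ℝ) / 2 ^ n ≤ u := by
    rw [div_le_iff₀ hpos, mul_comm]
    exact Int.floor_le _
  have h2 : v ≤ (((⌊2 ^ n * u⌋ + 1 : ℤ) : ℝ) + 1) / 2 ^ n := by
    refine h.trans ?_
    rw [le_div_iff₀ hpos, add_mul, one_div, inv_mul_cancel₀ hpos.ne', mul_comm u]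
    push_cast
    linarith [Int.lt_floor_add_one (2 ^ n * u)]
  have h3 := dyadicIncr_le_max_pow ha n ⌊2 ^ n * u⌋
  have h4 := dyadicIncr_le_max_pow ha n (⌊2 ^ n * u⌋ + 1)
  have h5 := lebesgueSingular_mono a h1
  have h6 := lebesgueSingular_mono a h2
  unfold dyadicIncr at h3 h4
  push_cast at h3 h4 h6
  linarith

theorem lebesgueSingular_continuous {a : unitInterval} (ha₀ : 0 < (a : ℝ)) (ha : (a : ℝ) < 1) :
    Continuous (lebesgueSingular a) := by
  rw [Metric.continuous_iff]
  intro u ε hε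
  obtain ⟨n, hn⟩ := exists_pow_lt_of_lt_one (y := max (a : ℝ) (1 - a)) (half_pos hε)
    (max_lt ha (by linarith))
  refine ⟨1 / 2 ^ n, by positivity, fun v hv => ?_⟩
  rw [Real.dist_eq, abs_lt] at hv
  have h1 := lebesgueSingular_sub_le ha n (u := u) (v := v) (by linarith)
  have h2 := lebesgueSingular_sub_le ha n (u := v) (v := u) (by linarith)
  rw [Real.dist_eq, abs_lt]
  constructor <;> linarith

theorem lebesgueSingular_surjOn {a : unitInterval} (ha₀ : 0 < (a : ℝ)) (ha : (a : ℝ) < 1) :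
    Set.SurjOn (lebesgueSingular a) (Set.Icc 0 1) (Set.Icc 0 1) := by
  have h := intermediate_value_Icc zero_le_one (lebesgueSingular_continuous ha₀ ha).continuousOn
  rwa [lebesgueSingular_zero ha, lebesgueSingular_of_one_le a le_rfl] at h

theorem lebesgueSingularInv_mem {a : unitInterval} (ha₀ : 0 < (a : ℝ)) (ha : (a : ℝ) < 1) {x : ℝ}
    (hx : x ∈ Set.Icc (0 : ℝ) 1) : lebesgueSingularInv a x ∈ Set.Icc (0 : ℝ) 1 :=
  Function.invFunOn_mem (lebesgueSingular_surjOn ha₀ ha hx)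

theorem lebesgueSingular_lebesgueSingularInv {a : unitInterval} (ha₀ : 0 < (a : ℝ))
    (ha : (a : ℝ) < 1) {x : ℝ} (hx : x ∈ Set.Icc (0 : ℝ) 1) :
    lebesgueSingular a (lebesgueSingularInv a x) = x :=
  Function.invFunOn_eq (lebesgueSingular_surjOn ha₀ ha hx)

theorem lebesgueSingular_mem (a : unitInterval) (y : ℝ) :
    lebesgueSingular a y ∈ Set.Icc (0 : ℝ) 1 :=
  ⟨measureReal_nonneg, measureReal_le_one⟩

theorem lebesgueSingularInv_lebesgueSingular {a : unitInterval} (ha₀ : 0 < (a : ℝ))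
    (ha : (a : ℝ) < 1) {y : ℝ} (hy : y ∈ Set.Icc (0 : ℝ) 1) :
    lebesgueSingularInv a (lebesgueSingular a y) = y :=
  (lebesgueSingular_strictMonoOn ha₀ ha).injOn
    (lebesgueSingularInv_mem ha₀ ha (lebesgueSingular_mem a y)) hy
    (lebesgueSingular_lebesgueSingularInv ha₀ ha (lebesgueSingular_mem a y))

theorem lebesgueSingularInv_strictMonoOn {a : unitInterval} (ha₀ : 0 < (a : ℝ))
    (ha : (a : ℝ) < 1) : StrictMonoOn (lebesgueSingularInv a) (Set.Icc 0 1) := by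
  intro x hx x' hx' h
  rw [← (lebesgueSingular_strictMonoOn ha₀ ha).lt_iff_lt (lebesgueSingularInv_mem ha₀ ha hx)
    (lebesgueSingularInv_mem ha₀ ha hx'), lebesgueSingular_lebesgueSingularInv ha₀ ha hx,
    lebesgueSingular_lebesgueSingularInv ha₀ ha hx']
  exact h

theorem lebesgueSingularInv_image {a : unitInterval} (ha₀ : 0 < (a : ℝ)) (ha : (a : ℝ) < 1) :
    lebesgueSingularInv a '' Set.Icc 0 1 = Set.Icc 0 1 := by
  refine Set.Subset.antisymm ?_ fun y hy => ⟨lebesgueSingular a y, lebesgueSingular_mem a y,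
    lebesgueSingularInv_lebesgueSingular ha₀ ha hy⟩
  rintro _ ⟨x, hx, rfl⟩
  exact lebesgueSingularInv_mem ha₀ ha hx

theorem lebesgueSingular_mem_Ioo {a : unitInterval} (ha₀ : 0 < (a : ℝ)) (ha : (a : ℝ) < 1)
    {y : ℝ} (hy : y ∈ Set.Ioo (0 : ℝ) 1) : lebesgueSingular a y ∈ Set.Ioo (0 : ℝ) 1 := by
  have hm := lebesgueSingular_strictMonoOn ha₀ ha
  have h0 := hm (Set.left_mem_Icc.2 zero_le_one) (Set.Ioo_subset_Icc_self hy) hy.1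
  have h1 := hm (Set.Ioo_subset_Icc_self hy) (Set.right_mem_Icc.2 zero_le_one) hy.2
  rw [lebesgueSingular_zero ha] at h0
  rw [lebesgueSingular_of_one_le a le_rfl] at h1
  exact ⟨h0, h1⟩

theorem binDigit_le_one (y : ℝ) (k : ℕ) : binDigit y k ≤ 1 := by
  unfold binDigit
  split_ifs <;> omega

theorem onesCount_eq_sum_range (y : ℝ) (n : ℕ) :
    onesCount y n = ∑ k ∈ Finset.range n, binDigit y (k + 1) := by
  rw [onesCount, Finset.range_eq_Ico, Finset.sum_Ico_add', zero_add]
  rfl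

theorem onesCount_succ (y : ℝ) (n : ℕ) :
    onesCount y (n + 1) = onesCount y n + binDigit y (n + 1) := by
  simp [onesCount_eq_sum_range, Finset.sum_range_succ]

theorem onesCount_le (y : ℝ) (n : ℕ) : onesCount y n ≤ n := by
  rw [onesCount_eq_sum_range]
  simpa using Finset.sum_le_card_nsmul (Finset.range n) _ 1 fun k _ => binDigit_le_one y (k + 1)

theorem floor_two_pow_add_div (y : ℝ) (n m : ℕ) :
    ⌊2 ^ (n + m) * y⌋₊ / 2 ^ m = ⌊2 ^ n * y⌋₊ := by
  rw [← Nat.cast_ofNat (R := ℝ), ← Nat.floor_div_natCast]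
  congr 1
  push_cast
  field_simp
  ring

theorem floor_two_pow_succ {y : ℝ} (hy : y ≠ 1) (n : ℕ) :
    ⌊2 ^ (n + 1) * y⌋₊ = 2 * ⌊2 ^ n * y⌋₊ + binDigit y (n + 1) := by
  have h := floor_two_pow_add_div y n 1
  rw [binDigit, if_neg hy]
  omega

theorem dyadicIncr_floor {a : unitInterval} (ha : (a : ℝ) < 1) {y : ℝ} (hy : y < 1) (n : ℕ) :
    dyadicIncr a n ⌊2 ^ n * y⌋₊ =
      (a : ℝ) ^ (n - onesCount y n) * (1 - a) ^ onesCount y n := by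
  induction n with
  | zero =>
    have : ⌊y⌋₊ = 0 := Nat.floor_eq_zero.2 hy
    simp [dyadicIncr_zero ha, onesCount, this]
  | succ n ih =>
    rw [floor_two_pow_succ hy.ne, onesCount_succ]
    have hle := onesCount_le y n
    rcases Nat.le_one_iff_eq_zero_or_eq_one.1 (binDigit_le_one y (n + 1)) with h | h
    · rw [h]
      push_cast
      rw [add_zero, dyadicIncr_succ_two_mul ha, ih, add_zero, Nat.sub_add_comm hle]
      ring
    · rw [h]
      push_cast
      rw [dyadicIncr_succ_two_mul_add_one ha, ih]
      ring

theorem dyadicIncr_add_le {a : unitInterval} (ha : (a : ℝ) < 1) (n m : ℕ) (j : ℤ) :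
    dyadicIncr a (n + m) j ≤ dyadicIncr a n (j / 2 ^ m) := by
  induction m generalizing j with
  | zero => simp
  | succ m ih =>
    rw [pow_succ', ← Int.ediv_ediv_of_nonneg (by norm_num)]
    refine le_trans ?_ (ih _)
    exact (dyadicIncr_succ_le_max_mul ha (n + m) j).trans
      (mul_le_of_le_one_left (dyadicIncr_nonneg _ _ _) (max_le ha.le (by linarith [a.2.1])))

/-- Dyadic intervals with a common ancestor `m` levels up have comparable increments. -/
theorem min_pow_mul_dyadicIncr_le {a : unitInterval} (ha : (a : ℝ) < 1) (n m : ℕ) {i j : ℤ}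
    (hij : i / 2 ^ m = j / 2 ^ m) :
    min (a : ℝ) (1 - a) ^ m * dyadicIncr a (n + m) i ≤ dyadicIncr a (n + m) j := by
  refine le_trans ?_ (min_pow_mul_le_dyadicIncr_add ha n m j)
  rw [← hij]
  have hp : 0 ≤ min (a : ℝ) (1 - a) := le_min a.2.1 (by linarith)
  gcongr
  exact dyadicIncr_add_le ha n m i

theorem add_one_ediv_two_pow_succ {j q : ℤ} {m : ℕ} (h : j / 2 ^ m = 2 * q) :
    j / 2 ^ (m + 1) = (j + 1) / 2 ^ (m + 1) := by
  have hpos : (0 : ℤ) < 2 ^ m := by positivity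
  have h1 := Int.mul_ediv_add_emod j (2 ^ m)
  have h2 := Int.emod_nonneg j hpos.ne'
  have h3 := Int.emod_lt_of_pos j hpos
  rw [h] at h1
  have key (i : ℤ) (h0 : 2 ^ (m + 1) * q ≤ i) (h1 : i < 2 ^ (m + 1) * q + 2 ^ (m + 1)) :
      i / 2 ^ (m + 1) = q :=
    (Int.ediv_emod_unique (b := 2 ^ (m + 1)) (r := i - 2 ^ (m + 1) * q) (by positivity)).2
      ⟨by ring, by linarith, by linarith⟩ |>.1
  rw [pow_succ] at *
  rw [key j (by linarith) (by linarith), key (j + 1) (by linarith) (by linarith)]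

theorem sub_one_ediv_two_pow_succ {j q : ℤ} {m : ℕ} (h : j / 2 ^ m = 2 * q + 1) :
    j / 2 ^ (m + 1) = (j - 1) / 2 ^ (m + 1) := by
  have hpos : (0 : ℤ) < 2 ^ m := by positivity
  have h1 := Int.mul_ediv_add_emod j (2 ^ m)
  have h2 := Int.emod_nonneg j hpos.ne'
  have h3 := Int.emod_lt_of_pos j hpos
  rw [h] at h1
  have key (i : ℤ) (h0 : 2 ^ (m + 1) * q ≤ i) (h1 : i < 2 ^ (m + 1) * q + 2 ^ (m + 1)) :
      i / 2 ^ (m + 1) = q :=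
    (Int.ediv_emod_unique (b := 2 ^ (m + 1)) (r := i - 2 ^ (m + 1) * q) (by positivity)).2
      ⟨by ring, by linarith, by linarith⟩ |>.1
  rw [pow_succ] at *
  rw [key j (by linarith) (by linarith), key (j - 1) (by linarith) (by linarith)]

/-- If the `(k+1)`-st binary digit of `y` is `0`, then at each level `n > k` the increment over the
right neighbour of the dyadic interval of `y` is not much smaller than the one over that interval. -/
theorem min_pow_mul_dyadicIncr_floor_le_right {a : unitInterval} (ha : (a : ℝ) < 1) {y : ℝ}
    (hy : y ≠ 1) {k n : ℕ} (hk : k < n) (h : binDigit y (k + 1) = 0) :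
    min (a : ℝ) (1 - a) ^ (n - k) * dyadicIncr a n ⌊2 ^ n * y⌋₊ ≤
      dyadicIncr a n (⌊2 ^ n * y⌋₊ + 1) := by
  obtain ⟨m, rfl⟩ := Nat.exists_eq_add_of_lt hk
  have h1 := floor_two_pow_succ hy k
  rw [h, ← floor_two_pow_add_div y (k + 1) m, add_zero] at h1
  rw [show k + 1 + m = k + m + 1 by ring] at h1
  rw [show k + m + 1 - k = m + 1 by omega]
  exact min_pow_mul_dyadicIncr_le ha k (m + 1)
    (add_one_ediv_two_pow_succ (q := ⌊2 ^ k * y⌋₊) (by exact_mod_cast h1))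

theorem min_pow_mul_dyadicIncr_floor_le_left {a : unitInterval} (ha : (a : ℝ) < 1) {y : ℝ}
    (hy : y ≠ 1) {k n : ℕ} (hk : k < n) (h : binDigit y (k + 1) = 1) :
    min (a : ℝ) (1 - a) ^ (n - k) * dyadicIncr a n ⌊2 ^ n * y⌋₊ ≤
      dyadicIncr a n (⌊2 ^ n * y⌋₊ - 1) := by
  obtain ⟨m, rfl⟩ := Nat.exists_eq_add_of_lt hk
  have h1 := floor_two_pow_succ hy k
  rw [h, ← floor_two_pow_add_div y (k + 1) m] at h1
  rw [show k + 1 + m = k + m + 1 by ring] at h1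
  rw [show k + m + 1 - k = m + 1 by omega]
  exact min_pow_mul_dyadicIncr_le ha k (m + 1)
    (sub_one_ediv_two_pow_succ (q := ⌊2 ^ k * y⌋₊) (by exact_mod_cast h1))

/-- If the averages of `b` tend to `d`, then `b` cannot be constantly equal to some `v ≠ d` on a
block of `n` of proportional length. -/
theorem eventually_exists_ne_of_tendsto_average {b : ℕ → ℝ} {d v δ : ℝ}
    (hb : Tendsto (fun n : ℕ => (∑ i ∈ Finset.range n, b i) / n) atTop (𝓝 d)) (hdv : d ≠ v)
    (hδ₀ : 0 < δ) (hδ₁ : δ < 1) :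
    ∀ᶠ n : ℕ in atTop, ∃ k < n, (1 - δ) * n ≤ k ∧ b k ≠ v := by
  have he : 0 < |d - v| := abs_pos.2 (sub_ne_zero.2 hdv)
  have hη : 0 < δ / 4 * |d - v| := by positivity
  have hclose : ∀ᶠ n : ℕ in atTop,
      |∑ i ∈ Finset.range n, b i - d * n| ≤ δ / 4 * |d - v| * n := by
    filter_upwards [(Metric.tendsto_nhds.1 hb) _ hη, eventually_gt_atTop 0] with n hn hn0
    have hn0' : (0 : ℝ) < n := by exact_mod_cast hn0
    have : ∑ i ∈ Finset.range n, b i - d * n =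
        ((∑ i ∈ Finset.range n, b i) / n - d) * n := by field_simp
    rw [this, abs_mul, abs_of_pos hn0']
    rw [Real.dist_eq] at hn
    gcongr
  have hceil : Tendsto (fun n : ℕ => ⌈(1 - δ) * (n : ℝ)⌉₊) atTop atTop :=
    tendsto_nat_ceil_atTop.comp
      (tendsto_natCast_atTop_atTop.const_mul_atTop (sub_pos.2 hδ₁))
  filter_upwards [hclose, hceil.eventually hclose, eventually_gt_atTop ⌈2 / δ⌉₊] with n h1 h2 h3
  by_contra! hcon
  set k := ⌈(1 - δ) * (n : ℝ)⌉₊ with hk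
  have hkn : k ≤ n := Nat.ceil_le.2 (by nlinarith [n.cast_nonneg (α := ℝ)])
  have hkn' : (k : ℝ) ≤ n := by exact_mod_cast hkn
  have hk1 : (k : ℝ) < (1 - δ) * n + 1 :=
    Nat.ceil_lt_add_one (mul_nonneg (by linarith) n.cast_nonneg)
  have hn : 2 < n * δ := by
    have := Nat.lt_of_ceil_lt h3
    rwa [div_lt_iff₀ hδ₀] at this
  have hsum : ∑ i ∈ Finset.range n, b i - ∑ i ∈ Finset.range k, b i = v * (n - k) := by
    rw [← Finset.sum_Ico_eq_sub _ hkn, Finset.sum_congr rfl (g := fun _ => v)]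
    · simp [Nat.cast_sub hkn]
      ring
    · intro i hi
      rw [Finset.mem_Ico] at hi
      exact hcon i hi.2 ((Nat.le_ceil _).trans (by exact_mod_cast hi.1))
  have h4 : |d - v| * (n - k) ≤ δ / 4 * |d - v| * n + δ / 4 * |d - v| * k := by
    calc |d - v| * (n - k) = |(d - v) * (n - k)| := by
          rw [abs_mul, abs_of_nonneg (sub_nonneg.2 hkn')]
      _ = |(∑ i ∈ Finset.range k, b i - d * k) - (∑ i ∈ Finset.range n, b i - d * n)| := by
          congr 1
          linear_combination hsum
      _ ≤ _ := by linarith [abs_sub (∑ i ∈ Finset.range k, b i - d * k)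
                    (∑ i ∈ Finset.range n, b i - d * n)]
  have h5 : (n : ℝ) - k ≤ δ / 2 * n := by
    have : |d - v| * ((n : ℝ) - k) ≤ |d - v| * (δ / 2 * n) := by nlinarith
    exact le_of_mul_le_mul_left this he
  linarith

theorem HasOnesDensity.eventually_exists_binDigit_ne {y d δ : ℝ} (h : HasOnesDensity y d) {v : ℕ}
    (hdv : d ≠ v) (hδ₀ : 0 < δ) (hδ₁ : δ < 1) :
    ∀ᶠ n : ℕ in atTop, ∃ k < n, (1 - δ) * n ≤ k ∧ binDigit y (k + 1) ≠ v := by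
  have := eventually_exists_ne_of_tendsto_average (b := fun k => (binDigit y (k + 1) : ℝ))
    (d := d) (v := v) (by simpa [HasOnesDensity, onesCount_eq_sum_range] using h) hdv hδ₀ hδ₁
  simpa using this

theorem HasOnesDensity.mem_Ioo {y d : ℝ} (h : HasOnesDensity y d) (hy : y ∈ Set.Icc (0 : ℝ) 1)
    (hd₀ : 0 < d) (hd₁ : d < 1) : y ∈ Set.Ioo (0 : ℝ) 1 := by
  refine ⟨hy.1.lt_of_ne' ?_, hy.2.lt_of_ne ?_⟩ <;> rintro rfl
  · obtain ⟨n, k, -, -, hk⟩ := (h.eventually_exists_binDigit_ne (v := 0) (by simpa using hd₀.ne')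
      (δ := 1 / 2) (by norm_num) (by norm_num)).exists
    simp [binDigit] at hk
  · obtain ⟨n, k, -, -, hk⟩ := (h.eventually_exists_binDigit_ne (v := 1) (by simpa using hd₁.ne)
      (δ := 1 / 2) (by norm_num) (by norm_num)).exists
    simp [binDigit] at hk

/-- If `D_1(y) = d` then `(1 / n) log` of the increment of `L_a` over the level `n` dyadic interval
of `y` tends to `log (a ^ (1 - d) * (1 - a) ^ d)`. -/
theorem HasOnesDensity.tendsto_log_dyadicIncr {a : unitInterval} (ha₀ : 0 < (a : ℝ))
    (ha : (a : ℝ) < 1) {y d : ℝ} (h : HasOnesDensity y d) (hy : y < 1) :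
    Tendsto (fun n : ℕ => Real.log (dyadicIncr a n ⌊2 ^ n * y⌋₊) / n) atTop
      (𝓝 ((1 - d) * Real.log a + d * Real.log (1 - a))) := by
  have h1 := ((h.const_sub 1).mul_const (Real.log a)).add (h.mul_const (Real.log (1 - a)))
  refine h1.congr' ?_
  filter_upwards [eventually_gt_atTop 0] with n hn
  have hn' : (n : ℝ) ≠ 0 := by exact_mod_cast hn.ne'
  rw [dyadicIncr_floor ha hy, Real.log_mul (pow_pos ha₀ _).ne' (pow_pos (by linarith) _).ne',
    Real.log_pow, Real.log_pow, Nat.cast_sub (onesCount_le y n)]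
  field_simp

theorem HasOnesDensity.exists_pow_le_dyadicIncr {a : unitInterval} (ha₀ : 0 < (a : ℝ))
    (ha : (a : ℝ) < 1) {y d : ℝ} (h : HasOnesDensity y d) (hy : y < 1) (hd₀ : 0 < d) (hd₁ : d < 1)
    (hd : (a : ℝ) ^ (1 - d) * (1 - (a : ℝ)) ^ d > 1 / 2) :
    ∃ τ > (1 / 2 : ℝ), ∀ᶠ n : ℕ in atTop,
      τ ^ n ≤ dyadicIncr a n (⌊2 ^ n * y⌋₊ + 1) ∧ τ ^ n ≤ dyadicIncr a n (⌊2 ^ n * y⌋₊ - 1) := by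
  have ha' : 0 < 1 - (a : ℝ) := by linarith
  set p := min (a : ℝ) (1 - a) with hp
  set l := (1 - d) * Real.log a + d * Real.log (1 - a) with hl
  have hp₀ : 0 < p := lt_min ha₀ ha'
  have hp₁ : p < 1 := (min_le_left _ _).trans_lt ha
  have hlogp : Real.log p < 0 := Real.log_neg hp₀ hp₁
  have hlog : Real.log (1 / 2) < l := by
    have := Real.log_lt_log (by norm_num) hd
    rwa [Real.log_mul (Real.rpow_pos_of_pos ha₀ _).ne' (Real.rpow_pos_of_pos ha' _).ne',
      Real.log_rpow ha₀, Real.log_rpow ha'] at this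
  obtain ⟨δ, hδl, hδ₀, hδ₁⟩ : ∃ δ, Real.log (1 / 2) < l + δ * Real.log p ∧ 0 < δ ∧ δ < 1 := by
    have hc : Tendsto (fun δ : ℝ => l + δ * Real.log p) (𝓝[>] 0) (𝓝 l) := by
      have : Continuous fun δ : ℝ => l + δ * Real.log p := by fun_prop
      simpa using (this.tendsto 0).mono_left nhdsWithin_le_nhds
    exact ((hc.eventually (lt_mem_nhds hlog)).and (Ioo_mem_nhdsGT one_pos)).exists
  obtain ⟨t, ht₁, ht₂⟩ := exists_between hδl
  refine ⟨Real.exp t, (Real.log_lt_iff_lt_exp (by norm_num)).1 ht₁, ?_⟩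
  have key : ∀ᶠ n : ℕ in atTop, ∀ k < n, (1 - δ) * n ≤ k →
      Real.exp t ^ n ≤ p ^ (n - k) * dyadicIncr a n ⌊2 ^ n * y⌋₊ := by
    filter_upwards [(h.tendsto_log_dyadicIncr ha₀ ha hy).eventually
      (lt_mem_nhds (show t - δ * Real.log p < l by linarith)), eventually_gt_atTop 0]
      with n hn hn0 k hkn hk
    have hn0' : (0 : ℝ) < n := by exact_mod_cast hn0
    have hpos : 0 < dyadicIncr a n ⌊2 ^ n * y⌋₊ := by
      rw [dyadicIncr_floor ha hy]
      positivity
    rw [lt_div_iff₀ hn0'] at hn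
    rw [← Real.log_le_log_iff (by positivity) (by positivity), Real.log_pow, Real.log_exp,
      Real.log_mul (by positivity) hpos.ne', Real.log_pow, Nat.cast_sub hkn.le]
    nlinarith
  filter_upwards [key, h.eventually_exists_binDigit_ne (v := 1) (by simpa using hd₁.ne) hδ₀ hδ₁,
    h.eventually_exists_binDigit_ne (v := 0) (by simpa using hd₀.ne') hδ₀ hδ₁] with n hn h0 h1
  obtain ⟨k, hkn, hk, hb⟩ := h0
  obtain ⟨k', hkn', hk', hb'⟩ := h1
  have hle := binDigit_le_one y (k + 1)
  have hle' := binDigit_le_one y (k' + 1)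
  exact ⟨(hn k hkn hk).trans
      (min_pow_mul_dyadicIncr_floor_le_right ha hy.ne hkn (by omega)),
    (hn k' hkn' hk').trans
      (min_pow_mul_dyadicIncr_floor_le_left ha hy.ne hkn' (by omega))⟩

theorem abs_abs_sub_round_sub_le (u v : ℝ) : |(|u - round u| - |v - round v|)| ≤ |u - v| := by
  have key (u v : ℝ) : |u - round u| ≤ |u - v| + |v - round v| :=
    (round_le u (round v)).trans (abs_sub_le u v (round v))
  rw [abs_le]
  have h1 := key u v
  have h2 := key v u
  rw [abs_sub_comm v u] at h2
  constructor <;> linarith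

theorem takagi_eq_tsum_round (x : ℝ) :
    takagi x = ∑' k : ℕ, 1 / 2 ^ k * |2 ^ k * x - round (2 ^ k * x)| := by
  simp only [takagi, round_eq]

theorem summable_takagi (x : ℝ) :
    Summable fun k : ℕ => 1 / 2 ^ k * |2 ^ k * x - round (2 ^ k * x)| := by
  refine Summable.of_nonneg_of_le (fun k => by positivity) (fun k => ?_) summable_geometric_two
  rw [one_div_pow]
  exact mul_le_of_le_one_right (by positivity) ((abs_sub_round _).trans (by norm_num))

theorem abs_takagi_sub_le (n : ℕ) (u v : ℝ) :
    |takagi u - takagi v| ≤ n * |u - v| + 2 / 2 ^ n := by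
  set f : ℝ → ℕ → ℝ := fun x k => 1 / 2 ^ k * |2 ^ k * x - round (2 ^ k * x)| with hf
  have hfd (k : ℕ) : f u k - f v k =
      1 / 2 ^ k * (|2 ^ k * u - round (2 ^ k * u)| - |2 ^ k * v - round (2 ^ k * v)|) := by
    simp only [hf]
    ring
  have hlip (k : ℕ) : |f u k - f v k| ≤ |u - v| := by
    rw [hfd, abs_mul, abs_of_pos (show (0 : ℝ) < 1 / 2 ^ k by positivity)]
    calc _ ≤ 1 / 2 ^ k * |2 ^ k * u - 2 ^ k * v| :=
          mul_le_mul_of_nonneg_left (abs_abs_sub_round_sub_le _ _) (by positivity)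
      _ = |u - v| := by
          rw [← mul_sub, abs_mul, abs_of_pos (show (0 : ℝ) < 2 ^ k by positivity)]
          field_simp
  have hbd (k : ℕ) : ‖f u (k + n) - f v (k + n)‖ ≤ (1 / 2) ^ k * (1 / 2 ^ n) := by
    rw [hfd, Real.norm_eq_abs, abs_mul, abs_of_pos (by positivity), one_div_pow,
      one_div_mul_one_div, ← pow_add]
    refine mul_le_of_le_one_right (by positivity) ?_
    have h1 := abs_sub_round (2 ^ (k + n) * u)
    have h2 := abs_sub_round (2 ^ (k + n) * v)
    have h3 := abs_nonneg (2 ^ (k + n) * u - round (2 ^ (k + n) * u))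
    have h4 := abs_nonneg (2 ^ (k + n) * v - round (2 ^ (k + n) * v))
    rw [abs_le]
    constructor <;> linarith
  have hs : Summable fun k => f u k - f v k := (summable_takagi u).sub (summable_takagi v)
  have htail := tsum_of_norm_bounded (hasSum_geometric_two.mul_right (1 / 2 ^ n : ℝ)) hbd
  rw [takagi_eq_tsum_round, takagi_eq_tsum_round,
    ← (summable_takagi u).tsum_sub (summable_takagi v), ← hs.sum_add_tsum_nat_add n]
  refine (abs_add_le _ _).trans (add_le_add ?_ ?_)
  · refine (Finset.abs_sum_le_sum_abs _ _).trans ?_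
    simpa using Finset.sum_le_card_nsmul (Finset.range n) _ _ fun k _ => hlip k
  · rw [Real.norm_eq_abs, mul_one_div] at htail
    exact htail

theorem dyadicIncr_right_le_sub (a : unitInterval) {n : ℕ} {y z : ℝ}
    (h : 2 / 2 ^ n ≤ z - y) (hy : 0 ≤ y) :
    dyadicIncr a n (⌊2 ^ n * y⌋₊ + 1) ≤ lebesgueSingular a z - lebesgueSingular a y := by
  have hpos : (0 : ℝ) < 2 ^ n := by positivity
  rw [div_le_iff₀ hpos] at h
  have h1 := Nat.floor_le (mul_nonneg hpos.le hy)
  have h2 := Nat.lt_floor_add_one (2 ^ n * y)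
  unfold dyadicIncr
  push_cast
  refine sub_le_sub (lebesgueSingular_mono a ?_) (lebesgueSingular_mono a ?_)
  · rw [div_le_iff₀ hpos]
    linarith
  · rw [le_div_iff₀ hpos]
    linarith

theorem dyadicIncr_left_le_sub (a : unitInterval) {n : ℕ} {y z : ℝ}
    (h : 2 / 2 ^ n ≤ y - z) (hy : 0 ≤ y) :
    dyadicIncr a n (⌊2 ^ n * y⌋₊ - 1) ≤ lebesgueSingular a y - lebesgueSingular a z := by
  have hpos : (0 : ℝ) < 2 ^ n := by positivity
  rw [div_le_iff₀ hpos] at h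
  have h1 := Nat.floor_le (mul_nonneg hpos.le hy)
  have h2 := Nat.lt_floor_add_one (2 ^ n * y)
  unfold dyadicIncr
  push_cast
  refine sub_le_sub (lebesgueSingular_mono a ?_) (lebesgueSingular_mono a ?_)
  · rw [div_le_iff₀ hpos]
    linarith
  · rw [le_div_iff₀ hpos]
    linarith

theorem eventually_mul_pow_le_mul_pow {τ c : ℝ} (hτ : 1 / 2 < τ) (hc : 0 < c) :
    ∀ᶠ n : ℕ in atTop, (n + 2) * (1 / 2 : ℝ) ^ n ≤ c * τ ^ (n + 2) := by
  have hτ₀ : 0 < τ := by linarith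
  have hr : 1 / 2 / τ < 1 := (div_lt_one hτ₀).2 hτ
  have hr₀ : 0 ≤ 1 / 2 / τ := by positivity
  have hlim : Tendsto (fun n : ℕ => (n : ℝ) * (1 / 2 / τ) ^ n + 2 * (1 / 2 / τ) ^ n) atTop
      (𝓝 (0 + 2 * 0)) :=
    (tendsto_self_mul_const_pow_of_lt_one hr₀ hr).add
      ((tendsto_pow_atTop_nhds_zero_of_lt_one hr₀ hr).const_mul 2)
  rw [mul_zero, add_zero] at hlim
  filter_upwards [hlim.eventually (gt_mem_nhds (show 0 < c * τ ^ 2 by positivity))] with n hn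
  rw [← add_mul, div_pow, mul_div_assoc', div_lt_iff₀ (by positivity)] at hn
  rw [pow_add]
  linarith

theorem HasOnesDensity.hasDerivAt_takagi_comp {a : unitInterval} (ha₀ : 0 < (a : ℝ))
    (ha : (a : ℝ) < 1) {x d : ℝ} (hx : x ∈ Set.Icc (0 : ℝ) 1)
    (h : HasOnesDensity (lebesgueSingularInv a x) d) (hd₀ : 0 < d) (hd₁ : d < 1)
    (hd : (a : ℝ) ^ (1 - d) * (1 - (a : ℝ)) ^ d > 1 / 2) :
    HasDerivAt (takagi ∘ lebesgueSingularInv a) 0 x := by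
  have hy := h.mem_Ioo (lebesgueSingularInv_mem ha₀ ha hx) hd₀ hd₁
  have hLy := lebesgueSingular_lebesgueSingularInv ha₀ ha hx
  have hx' : x ∈ Set.Ioo (0 : ℝ) 1 := hLy ▸ lebesgueSingular_mem_Ioo ha₀ ha hy
  have hIcc : Set.Icc (0 : ℝ) 1 ∈ 𝓝 x := Icc_mem_nhds hx'.1 hx'.2
  have hcont : ContinuousAt (lebesgueSingularInv a) x :=
    (lebesgueSingularInv_strictMonoOn ha₀ ha).continuousAt_of_image_mem_nhds hIcc
      (by rw [lebesgueSingularInv_image ha₀ ha]; exact Icc_mem_nhds hy.1 hy.2)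
  obtain ⟨τ, hτ, hτn⟩ := h.exists_pow_le_dyadicIncr ha₀ ha hy.2 hd₀ hd₁ hd
  set y := lebesgueSingularInv a x with hydef
  rw [hasDerivAt_iff_isLittleO, Asymptotics.isLittleO_iff]
  intro c hc
  obtain ⟨N, hN⟩ := eventually_atTop.1
    (((tendsto_add_atTop_nat 2).eventually hτn).and (eventually_mul_pow_le_mul_pow hτ hc))
  filter_upwards [hIcc, Metric.tendsto_nhds.1 hcont ((1 / 2) ^ (N + 1)) (by positivity)]
    with x' hx'' hclose
  have hLz := lebesgueSingular_lebesgueSingularInv ha₀ ha hx''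
  rw [← hydef] at hclose
  simp only [Function.comp_apply, smul_zero, sub_zero, ← hydef]
  set z := lebesgueSingularInv a x'
  rw [Real.dist_eq] at hclose
  rcases eq_or_ne z y with hzy | hzy
  · rw [hzy]
    simp only [sub_self, norm_zero]
    positivity
  obtain ⟨n, hn₁, hn₂⟩ := exists_nat_pow_near_of_lt_one (abs_pos.2 (sub_ne_zero.2 hzy))
    (hclose.le.trans (pow_le_one₀ (by norm_num) (by norm_num)))
    (show (0 : ℝ) < 1 / 2 by norm_num) (by norm_num)
  have hNn : N ≤ n := by
    have := (pow_lt_pow_iff_right_of_lt_one₀ (show (0 : ℝ) < 1 / 2 by norm_num)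
      (by norm_num)).1 (hn₁.trans hclose)
    omega
  obtain ⟨⟨hR, hLt⟩, hgrow⟩ := hN n hNn
  have hT : |takagi z - takagi y| ≤ (n + 2) * (1 / 2) ^ n := by
    refine (abs_takagi_sub_le n z y).trans ?_
    rw [add_mul, one_div_pow, mul_one_div 2] at *
    gcongr
  have hscale : (2 : ℝ) / 2 ^ (n + 2) = (1 / 2) ^ (n + 1) := by
    rw [one_div_pow, pow_succ _ (n + 1)]
    field_simp
  have hL : τ ^ (n + 2) ≤ |x' - x| := by
    rw [← hLy, ← hLz]
    rcases hzy.lt_or_gt with hlt | hlt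
    · rw [abs_of_neg (sub_neg.2 hlt), neg_sub] at hn₁
      rw [abs_sub_comm]
      exact (hLt.trans (dyadicIncr_left_le_sub a (by rw [hscale]; exact hn₁.le) hy.1.le)).trans
        (le_abs_self _)
    · rw [abs_of_pos (sub_pos.2 hlt)] at hn₁
      exact (hR.trans (dyadicIncr_right_le_sub a (by rw [hscale]; exact hn₁.le) hy.1.le)).trans
        (le_abs_self _)
  rw [Real.norm_eq_abs, Real.norm_eq_abs]
  exact hT.trans (hgrow.trans (by gcongr))

theorem ofDigits_lt_one {b : ℕ → Fin 2} {i : ℕ} (hi : b i = 0) : Real.ofDigits b < 1 := by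
  have h1 : Real.ofDigits (fun _ : ℕ => (1 : Fin 2)) = 1 := Real.ofDigits_const_last_eq_one 1
  rw [← h1]
  refine Summable.tsum_lt_tsum (i := i) (fun n => ?_) ?_ Real.summable_ofDigitsTerm
    Real.summable_ofDigitsTerm
  · refine Real.ofDigitsTerm_le.trans_eq ?_
    norm_num [Real.ofDigitsTerm]
  · simp [Real.ofDigitsTerm, hi]

theorem two_mul_ofDigits (b : ℕ → Fin 2) :
    2 * Real.ofDigits b = (b 0 : ℕ) + Real.ofDigits fun i => b (i + 1) := by
  rw [Real.ofDigits_eq_sum_add_ofDigits b 1]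
  simp [Real.ofDigitsTerm]
  ring

theorem exists_two_pow_mul_ofDigits_eq (b : ℕ → Fin 2) (k : ℕ) :
    ∃ N : ℕ, 2 ^ k * Real.ofDigits b = N + Real.ofDigits fun i => b (i + k) := by
  induction k with
  | zero => exact ⟨0, by simp⟩
  | succ k ih =>
    obtain ⟨N, hN⟩ := ih
    refine ⟨2 * N + b k, ?_⟩
    rw [pow_succ', mul_assoc, hN, mul_add, two_mul_ofDigits]
    simp only [zero_add, add_right_comm _ 1 k, add_assoc _ k 1]
    push_cast
    ring

theorem binDigit_ofDigits {b : ℕ → Fin 2} (hb : ∀ k, ∃ i, b (i + k) = 0) (k : ℕ) :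
    binDigit (Real.ofDigits b) (k + 1) = b k := by
  obtain ⟨i₀, hi₀⟩ := hb 0
  obtain ⟨i, hi⟩ := hb (k + 1)
  obtain ⟨N, hN⟩ := exists_two_pow_mul_ofDigits_eq b k
  have hlt : Real.ofDigits (fun i => b (i + (k + 1))) < 1 := ofDigits_lt_one hi
  have hfloor : ⌊2 ^ (k + 1) * Real.ofDigits b⌋₊ = 2 * N + b k := by
    rw [pow_succ', mul_assoc, hN, mul_add, two_mul_ofDigits, Nat.floor_eq_iff]
    · simp only [zero_add, add_right_comm _ 1 k, add_assoc _ k 1]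
      have := Real.ofDigits_nonneg fun i => b (i + (k + 1))
      push_cast
      constructor <;> linarith
    · have := Real.ofDigits_nonneg fun i => b (i + 1 + k)
      positivity
  rw [binDigit, if_neg (ofDigits_lt_one hi₀).ne, hfloor]
  have := (b k).isLt
  omega

/-- Every `d ∈ (0, 1)` is the density of ones of some number, for instance of the one with the
Sturmian digits `⌊(n + 1) d⌋ - ⌊n d⌋`. -/
theorem exists_hasOnesDensity {d : ℝ} (hd₀ : 0 < d) (hd₁ : d < 1) :
    ∃ y ∈ Set.Ioo (0 : ℝ) 1, HasOnesDensity y d := by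
  have hstep (n : ℕ) : ⌊(n : ℝ) * d⌋₊ ≤ ⌊((n + 1 : ℕ) : ℝ) * d⌋₊ ∧
      ⌊((n + 1 : ℕ) : ℝ) * d⌋₊ ≤ ⌊(n : ℝ) * d⌋₊ + 1 := by
    constructor
    · gcongr
      exact n.le_succ
    · rw [← Nat.floor_add_one (by positivity)]
      gcongr
      push_cast
      linarith
  set b : ℕ → Fin 2 := fun n =>
    ⟨⌊((n + 1 : ℕ) : ℝ) * d⌋₊ - ⌊(n : ℝ) * d⌋₊, by have := hstep n; omega⟩ with hb
  have hbval (n : ℕ) : ⌊((n + 1 : ℕ) : ℝ) * d⌋₊ = ⌊(n : ℝ) * d⌋₊ + b n := by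
    have := (hstep n).1
    simp only [hb]
    omega
  have hzero : ∀ k, ∃ i, b (i + k) = 0 := by
    intro k
    by_contra! hcon
    have hone (i : ℕ) : (b (i + k) : ℕ) = 1 := by
      have h1 := hcon i
      have h2 := (b (i + k)).isLt
      rw [Ne, Fin.ext_iff, Fin.val_zero] at h1
      omega
    have hlin (i : ℕ) : ⌊((i + k : ℕ) : ℝ) * d⌋₊ = ⌊(k : ℝ) * d⌋₊ + i := by
      induction i with
      | zero => simp
      | succ i ih => rw [add_right_comm, hbval, ih, hone, add_assoc]
    obtain ⟨i, hi⟩ := exists_nat_gt (k * d / (1 - d))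
    rw [div_lt_iff₀ (sub_pos.2 hd₁)] at hi
    have h1 : ((⌊((i + k : ℕ) : ℝ) * d⌋₊ : ℕ) : ℝ) ≤ ((i + k : ℕ) : ℝ) * d :=
      Nat.floor_le (by positivity)
    rw [hlin] at h1
    push_cast at h1
    have h2 : (0 : ℝ) ≤ ⌊(k : ℝ) * d⌋₊ := Nat.cast_nonneg _
    linarith
  have hcount (n : ℕ) : onesCount (Real.ofDigits b) n = ⌊d * (n : ℝ)⌋₊ := by
    rw [mul_comm]
    induction n with
    | zero => simp [onesCount]
    | succ n ih => rw [onesCount_succ, ih, binDigit_ofDigits hzero, hbval]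
  have hdens : HasOnesDensity (Real.ofDigits b) d := by
    simp only [HasOnesDensity, hcount]
    exact (tendsto_nat_floor_mul_div_atTop hd₀.le).comp tendsto_natCast_atTop_atTop
  exact ⟨_, hdens.mem_Ioo ⟨Real.ofDigits_nonneg b, Real.ofDigits_le_one b⟩ hd₀ hd₁, hdens⟩

theorem not_countable_setOf_half_lt_rpow_mul_rpow {a : ℝ} (ha₀ : 0 < a) (ha₁ : a < 1)
    (ha : a ≠ 1 / 2) :
    ¬ (Set.Ioo (0 : ℝ) 1 ∩ {d | 1 / 2 < a ^ (1 - d) * (1 - a) ^ d}).Countable := by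
  have ha' : 0 < 1 - a := by linarith
  have hcont : Continuous fun d : ℝ => a ^ (1 - d) * (1 - a) ^ d :=
    (continuous_const.rpow (by fun_prop) fun _ => Or.inl ha₀.ne').mul
      (continuous_const.rpow continuous_id fun _ => Or.inl ha'.ne')
  have hopen : IsOpen (Set.Ioo (0 : ℝ) 1 ∩ {d | 1 / 2 < a ^ (1 - d) * (1 - a) ^ d}) :=
    isOpen_Ioo.inter (isOpen_lt continuous_const hcont)
  have hne : (Set.Ioo (0 : ℝ) 1 ∩ {d | 1 / 2 < a ^ (1 - d) * (1 - a) ^ d}).Nonempty := by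
    rcases ha.lt_or_gt with h | h
    · have h1 : ∀ᶠ d in 𝓝[<] (1 : ℝ), 1 / 2 < a ^ (1 - d) * (1 - a) ^ d :=
        (hcont.tendsto 1).mono_left nhdsWithin_le_nhds (lt_mem_nhds (by norm_num; linarith))
      exact (Filter.Eventually.and (Ioo_mem_nhdsLT one_pos) h1).exists
    · have h1 : ∀ᶠ d in 𝓝[>] (0 : ℝ), 1 / 2 < a ^ (1 - d) * (1 - a) ^ d :=
        (hcont.tendsto 0).mono_left nhdsWithin_le_nhds (lt_mem_nhds (by norm_num at h ⊢; linarith))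
      exact (Filter.Eventually.and (Ioo_mem_nhdsGT one_pos) h1).exists
  intro hc
  obtain ⟨d, hd⟩ := hne
  obtain ⟨l, u, hdlu, hsub⟩ := mem_nhds_iff_exists_Ioo_subset.1 (hopen.mem_nhds hd)
  exact absurd (Cardinal.Real.Ioo_countable_iff.1 (hc.mono hsub)) (hdlu.1.trans hdlu.2).not_ge

theorem theorem3 (a : unitInterval) (ha₀ : 0 < (a : ℝ)) (ha₁ : (a : ℝ) < 1)
    (ha : (a : ℝ) ≠ 1 / 2) :
    (∀ x ∈ Set.Icc (0 : ℝ) 1, ∀ d₁ : ℝ,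
      HasOnesDensity (lebesgueSingularInv a x) d₁ → 0 < d₁ → d₁ < 1 →
      (a : ℝ) ^ (1 - d₁) * (1 - (a : ℝ)) ^ d₁ > 1 / 2 →
      HasDerivAt (takagi ∘ lebesgueSingularInv a) 0 x) ∧
    ¬ {x ∈ Set.Ioo (0 : ℝ) 1 |
      HasDerivAt (takagi ∘ lebesgueSingularInv a) 0 x}.Countable := by
  refine ⟨fun x hx d h hd₀ hd₁ hd => h.hasDerivAt_takagi_comp ha₀ ha₁ hx hd₀ hd₁ hd, fun hc => ?_⟩
  refine not_countable_setOf_half_lt_rpow_mul_rpow ha₀ ha₁ ha ?_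
  have hex (d : ℝ) : ∃ y, d ∈ Set.Ioo (0 : ℝ) 1 → y ∈ Set.Ioo (0 : ℝ) 1 ∧ HasOnesDensity y d := by
    by_cases hd : d ∈ Set.Ioo (0 : ℝ) 1
    · obtain ⟨y, hy, h⟩ := exists_hasOnesDensity hd.1 hd.2
      exact ⟨y, fun _ => ⟨hy, h⟩⟩
    · exact ⟨0, fun h => absurd h hd⟩
  choose y hy using hex
  refine Set.MapsTo.countable_of_injOn (f := fun d => lebesgueSingular a (y d)) ?_ ?_ hc
  · rintro d ⟨hd, hd'⟩
    obtain ⟨hyd, hdens⟩ := hy d hd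
    refine ⟨lebesgueSingular_mem_Ioo ha₀ ha₁ hyd, ?_⟩
    refine HasOnesDensity.hasDerivAt_takagi_comp ha₀ ha₁ (lebesgueSingular_mem a _) (d := d) ?_
      hd.1 hd.2 hd'
    rwa [lebesgueSingularInv_lebesgueSingular ha₀ ha₁ (Set.Ioo_subset_Icc_self hyd)]
  · rintro d ⟨hd, -⟩ e ⟨he, -⟩ hde
    have hyde : y d = y e := (lebesgueSingular_strictMonoOn ha₀ ha₁).injOn
      (Set.Ioo_subset_Icc_self (hy d hd).1) (Set.Ioo_subset_Icc_self (hy e he).1) hde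
    have h := (hy d hd).2
    rw [hyde] at h
    exact tendsto_nhds_unique h (hy e he).2
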